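/- Let $m,n$ be nonzero coprime integers. Let $\widetilde U_{m,n}=\mathbb C[\alpha_1]\otimes\big(\bigoplus_{k\in\mathbb Z}\mathbb C a_k\big)\otimes\mathbb C[\alpha_2]$ be the modified enveloping algebra: the associative (non-unital) $\mathbb C$-algebra with basis $\alpha_1^r a_k\alpha_2^s$ ($r,s\ge 0$, $k\in\mathbb Z$) and multiplication determined by $$a_ka_\ell=\delta_{k\ell}a_k,\qquad \alpha_1a_k=a_{k+m}\alpha_1,\qquad \alpha_2a_k=a_{k+n}\alpha_2,\qquad \alpha_1\alpha_2a_k=\alpha_2\alpha_1a_k\qquad(k,\ell\in\mathbb Z).$$ Let $\widetilde U_{m,n}\text{-Mod}$ be the category of left $\widetilde U_{m,n}$-modules $V$ (complex vector spaces of arbitrary dimension) that are the sum of their weight spaces, $V=\bigoplus_{k\in\mathbb Z}V_k$ with $V_k=a_kV$. For integers $a\le b$ let $\mathcal C^{m,n}_{a,b}$ be the full subcategory of $\widetilde U_{m,n}\text{-Mod}$ consisting of the modules $V$ such that $V_k=0$ whenever $k<a$ or $k>b$. **Theorem.** If $n\neq 1$ and $0\le b-a\le m$, then $\mathcal C^{m,n}_{a,b}$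 is of finite representation type, that is, it has only finitely many isomorphism classes of indecomposable objects. -/

import Mathlib

open CategoryTheory CategoryTheory.Limits

universe u

/-- The modified enveloping algebra `Ũ_{m,n} = U¹ ⊗ (⨁ₖ ℂ aₖ) ⊗ U²`, where `U¹ = ℂ[α₁]`,
`U² = ℂ[α₂]`, as a complex vector space: the basis vector `(r, k, s)` is `α₁ʳ aₖ α₂ˢ`. -/
def ModEnv (_m _n : ℤ) : Type := (ℕ × ℤ × ℕ) →₀ ℂ

namespace ModEnv

variable (m n : ℤ)

noncomputable instance : AddCommGroup (ModEnv m n) :=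
  inferInstanceAs (AddCommGroup ((ℕ × ℤ × ℕ) →₀ ℂ))

noncomputable instance : Module ℂ (ModEnv m n) :=
  inferInstanceAs (Module ℂ ((ℕ × ℤ × ℕ) →₀ ℂ))

/-- The basis element `α₁ʳ aₖ α₂ˢ`, for `p = (r, k, s)`. -/
noncomputable def mono (p : ℕ × ℤ × ℕ) : ModEnv m n := Finsupp.single p 1

/-- The idempotent `aₖ`. -/
noncomputable def idem (k : ℤ) : ModEnv m n := mono m n (0, k, 0)

/-- The product of two basis elements. The relations `aₖ a_l = δ_{kl} aₖ`, `α₁ aₖ = a_{k+m} α₁`,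
`α₂ aₖ = a_{k+n} α₂`, `α₁ α₂ aₖ = α₂ α₁ aₖ` give
`α₁ʳ aₖ α₂ˢ · α₁ʳ' a_l α₂ˢ' = α₁ʳ⁺ʳ' a_{k - r'm} a_{l + sn} α₂ˢ⁺ˢ'`. -/
noncomputable def monoMul (p q : ℕ × ℤ × ℕ) : ModEnv m n :=
  if p.2.1 - q.1 * m = q.2.1 + p.2.2 * n then
    mono m n (p.1 + q.1, q.2.1 + p.2.2 * n, p.2.2 + q.2.2)
  else 0

/-- The bilinear extension of `monoMul`. -/
noncomputable def mulLin : ModEnv m n →ₗ[ℂ] ModEnv m n →ₗ[ℂ] ModEnv m n :=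
  Finsupp.linearCombination ℂ
    (fun p => (Finsupp.linearCombination ℂ (monoMul m n p) : ModEnv m n →ₗ[ℂ] ModEnv m n))

noncomputable instance : Mul (ModEnv m n) := ⟨fun x y => mulLin m n x y⟩

theorem mul_def (x y : ModEnv m n) : x * y = mulLin m n x y := rfl

theorem mono_mul_mono (p q : ℕ × ℤ × ℕ) :
    mono m n p * mono m n q = monoMul m n p q := by
  rw [mul_def]
  unfold mulLin mono
  erw [Finsupp.linearCombination_single, one_smul, Finsupp.linearCombination_single, one_smul]

theorem induction_mono {P : ModEnv m n → Prop} (h0 : P 0)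
    (hadd : ∀ x y, P x → P y → P (x + y)) (hsm : ∀ (c : ℂ) p, P (c • mono m n p))
    (x : ModEnv m n) : P x := by
  refine Finsupp.induction_linear (motive := P) x h0 hadd fun p c => ?_
  have h := hsm c p
  unfold mono at h
  erw [Finsupp.smul_single_one] at h
  exact h

theorem mono_mul_assoc (p q r : ℕ × ℤ × ℕ) :
    mono m n p * mono m n q * mono m n r = mono m n p * (mono m n q * mono m n r) := by
  obtain ⟨p1, p2, p3⟩ := p
  obtain ⟨q1, q2, q3⟩ := q
  obtain ⟨r1, r2, r3⟩ := r
  have hz : ∀ x : ModEnv m n, 0 * x = 0 := fun x => by simp [mul_def]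
  have hz' : ∀ x : ModEnv m n, x * 0 = 0 := fun x => by simp [mul_def]
  simp only [mono_mul_mono, monoMul]
  by_cases h1 : p2 - q1 * m = q2 + p3 * n <;> by_cases h2 : q2 - r1 * m = r2 + q3 * n
  · rw [if_pos h1, if_pos h2, mono_mul_mono, mono_mul_mono]
    simp only [monoMul]
    rw [if_pos (by push_cast; linarith), if_pos (by push_cast; linarith)]
    congr 1
    refine Prod.ext (by simp; ring) (Prod.ext ?_ (by simp; ring))
    push_cast
    ring
  · rw [if_pos h1, if_neg h2, hz', mono_mul_mono]
    simp only [monoMul]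
    rw [if_neg]
    intro h
    apply h2
    push_cast at h
    linarith
  · rw [if_neg h1, if_pos h2, hz, mono_mul_mono]
    simp only [monoMul]
    rw [if_neg]
    intro h
    apply h1
    push_cast at h
    linarith
  · rw [if_neg h1, if_neg h2, hz, hz']

noncomputable instance : NonUnitalRing (ModEnv m n) where
  left_distrib x y z := by simp [mul_def]
  right_distrib x y z := by simp [mul_def]
  zero_mul x := by simp [mul_def]
  mul_zero x := by simp [mul_def]
  mul_assoc x y z := by
    have hl : ∀ x y z : ModEnv m n, (x + y) * z = x * z + y * z := fun x y z => by simp [mul_def]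
    have hr : ∀ x y z : ModEnv m n, x * (y + z) = x * y + x * z := fun x y z => by simp [mul_def]
    have hz : ∀ x : ModEnv m n, 0 * x = 0 := fun x => by simp [mul_def]
    have hz' : ∀ x : ModEnv m n, x * 0 = 0 := fun x => by simp [mul_def]
    have hsl : ∀ (c : ℂ) (x y : ModEnv m n), (c • x) * y = c • (x * y) := fun c x y => by
      simp [mul_def]
    have hsr : ∀ (c : ℂ) (x y : ModEnv m n), x * (c • y) = c • (x * y) := fun c x y => by
      simp [mul_def]
    induction x using induction_mono with
    | h0 => simp only [hz]
    | hadd x x' hx hx' => simp only [hl, hx, hx']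
    | hsm c p =>
      induction y using induction_mono with
      | h0 => simp only [hz, hz']
      | hadd x x' hx hx' => simp only [hl, hr, hx, hx']
      | hsm d q =>
        induction z using induction_mono with
        | h0 => simp only [hz']
        | hadd x x' hx hx' => simp only [hr, hx, hx']
        | hsm e r => simp only [hsl, hsr, mono_mul_assoc]

instance : IsScalarTower ℂ (ModEnv m n) (ModEnv m n) :=
  ⟨fun c x y => by simp [mul_def]⟩

instance : SMulCommClass ℂ (ModEnv m n) (ModEnv m n) :=
  ⟨fun c x y => by simp [mul_def]⟩

end ModEnv

/-- A left module over the (non-unital) algebra `Ũ_{m,n}`: a complex vector space `V` with an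
algebra homomorphism `Ũ_{m,n} → End V`, such that `V` is the sum of its weight spaces
`V_k = aₖ V`. The sum is then direct, because the `aₖ` are orthogonal idempotents, and the
condition is the usual requirement `Ũ_{m,n} V = V` on modules over a ring with enough idempotents. -/
structure ModEnvMod (m n : ℤ) where
  /-- the underlying vector space -/
  carrier : Type u
  [addCommGroup : AddCommGroup carrier]
  [module : Module ℂ carrier]
  /-- the action -/
  act : ModEnv m n →ₙₐ[ℂ] Module.End ℂ carrier
  iSup_weight : (⨆ k : ℤ, LinearMap.range (act (ModEnv.idem m n k))) = ⊤

namespace ModEnvMod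

attribute [instance] ModEnvMod.addCommGroup ModEnvMod.module

variable {m n : ℤ}

/-- The `k`-th weight space `V_k = aₖ V`. -/
noncomputable def weightSpace (V : ModEnvMod.{u} m n) (k : ℤ) : Submodule ℂ V.carrier :=
  LinearMap.range (V.act (ModEnv.idem m n k))

/-- The space of module homomorphisms. -/
noncomputable def homSpace (V W : ModEnvMod.{u} m n) : Submodule ℂ (V.carrier →ₗ[ℂ] W.carrier) where
  carrier := {f | ∀ (x : ModEnv m n) (v : V.carrier), f (V.act x v) = W.act x (f v)}
  add_mem' hf hg x v := by simp [hf x v, hg x v]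
  zero_mem' x v := by simp
  smul_mem' c f hf x v := by simp [hf x v]

/-- The category `Ũ_{m,n}-Mod`. -/
noncomputable instance : Category (ModEnvMod.{u} m n) where
  Hom V W := homSpace V W
  id _ := ⟨LinearMap.id, fun _ _ => rfl⟩
  comp f g := ⟨g.1.comp f.1, fun x v => by simp [f.2 x v, g.2 x (f.1 v)]⟩

noncomputable instance (V W : ModEnvMod.{u} m n) : AddCommGroup (V ⟶ W) :=
  inferInstanceAs (AddCommGroup (homSpace V W))

noncomputable instance : Preadditive (ModEnvMod.{u} m n) where
  homGroup _ _ := inferInstance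
  add_comp _ _ _ f f' g := Subtype.ext (LinearMap.comp_add f.1 f'.1 g.1)
  comp_add _ _ _ f g g' := Subtype.ext (LinearMap.add_comp f.1 g'.1 g.1)

/-- The direct sum of two modules. -/
noncomputable def directSum (V W : ModEnvMod.{u} m n) : ModEnvMod.{u} m n where
  carrier := V.carrier × W.carrier
  act :=
    { toFun := fun x => (V.act x).prodMap (W.act x)
      map_smul' := fun c x => by ext <;> simp
      map_zero' := by ext <;> simp
      map_add' := fun x y => by ext <;> simp
      map_mul' := fun x y => by ext <;> simp }
  iSup_weight := by
    rw [eq_top_iff]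
    rintro ⟨v, w⟩ -
    have hv : v ∈ ⨆ k : ℤ, LinearMap.range (V.act (ModEnv.idem m n k)) := by
      rw [V.iSup_weight]; trivial
    have hw : w ∈ ⨆ k : ℤ, LinearMap.range (W.act (ModEnv.idem m n k)) := by
      rw [W.iSup_weight]; trivial
    have key : ((v, w) : V.carrier × W.carrier) = LinearMap.inl ℂ _ _ v + LinearMap.inr ℂ _ _ w := by
      simp
    rw [key]
    refine Submodule.add_mem _ ?_ ?_
    · have := Submodule.mem_map_of_mem (f := LinearMap.inl ℂ V.carrier W.carrier) hv
      rw [Submodule.map_iSup] at this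
      revert this
      apply SetLike.le_def.mp
      refine iSup_mono fun k => ?_
      rintro _ ⟨_, ⟨y, rfl⟩, rfl⟩
      exact ⟨(y, 0), by simp⟩
    · have := Submodule.mem_map_of_mem (f := LinearMap.inr ℂ V.carrier W.carrier) hw
      rw [Submodule.map_iSup] at this
      revert this
      apply SetLike.le_def.mp
      refine iSup_mono fun k => ?_
      rintro _ ⟨_, ⟨y, rfl⟩, rfl⟩
      exact ⟨(0, y), by simp⟩

/-- The property that `V_k = 0` whenever `k < a` or `k > b`. -/
def supportedOn (m n a b : ℤ) : ObjectProperty (ModEnvMod.{u} m n) :=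
  fun V => ∀ k : ℤ, (k < a ∨ b < k) → V.weightSpace k = ⊥

theorem directSum_supportedOn {a b : ℤ} {V W : ModEnvMod.{u} m n}
    (hV : supportedOn m n a b V) (hW : supportedOn m n a b W) :
    supportedOn m n a b (directSum V W) := by
  intro k hk
  have h1 := hV k hk
  have h2 := hW k hk
  unfold weightSpace at h1 h2 ⊢
  rw [LinearMap.range_eq_bot] at h1 h2 ⊢
  change (V.act _).prodMap (W.act _) = 0
  rw [h1, h2]
  ext <;> simp

/-- The full subcategory `C^{m,n}_{a,b}` of `Ũ_{m,n}-Mod` consisting of the modules `V` with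
`V_k = 0` whenever `k < a` or `k > b`. -/
abbrev SupportCat (m n a b : ℤ) := (supportedOn.{u} m n a b).FullSubcategory

/-- The direct sum of modules is a biproduct in `C^{m,n}_{a,b}`. -/
noncomputable def bicone {a b : ℤ} (V W : SupportCat.{u} m n a b) : BinaryBicone V W where
  pt := ⟨directSum V.obj W.obj, directSum_supportedOn V.property W.property⟩
  fst := ObjectProperty.homMk ⟨LinearMap.fst ℂ V.obj.carrier W.obj.carrier, fun _ _ => rfl⟩
  snd := ObjectProperty.homMk ⟨LinearMap.snd ℂ V.obj.carrier W.obj.carrier, fun _ _ => rfl⟩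
  inl := ObjectProperty.homMk ⟨LinearMap.inl ℂ V.obj.carrier W.obj.carrier, fun x _ =>
    Prod.ext rfl (map_zero (W.obj.act x)).symm⟩
  inr := ObjectProperty.homMk ⟨LinearMap.inr ℂ V.obj.carrier W.obj.carrier, fun x _ =>
    Prod.ext (map_zero (V.obj.act x)).symm rfl⟩
  inl_fst := ObjectProperty.hom_ext _ (Subtype.ext (LinearMap.fst_comp_inl ℂ _ _))
  inl_snd := ObjectProperty.hom_ext _ (Subtype.ext (LinearMap.snd_comp_inl ℂ _ _))
  inr_fst := ObjectProperty.hom_ext _ (Subtype.ext (LinearMap.fst_comp_inr ℂ _ _))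
  inr_snd := ObjectProperty.hom_ext _ (Subtype.ext (LinearMap.snd_comp_inr ℂ _ _))

instance (a b : ℤ) : HasBinaryBiproducts (SupportCat.{u} m n a b) where
  has_binary_biproduct V W := hasBinaryBiproduct_of_total (bicone V W)
    (ObjectProperty.hom_ext _ (Subtype.ext (LinearMap.ext fun v => by
      exact Prod.fst_add_snd (M := V.obj.carrier) (N := W.obj.carrier) v)))

end ModEnvMod

/-- A category of modules has finite representation type if it has only finitely many isomorphism
classes of indecomposable objects. (No restriction is put on the dimension of the objects.) -/
def IsFiniteRepType (C : Type*) [Category C] [HasZeroMorphisms C] [HasBinaryBiproducts C] : Prop :=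
  {q : Quotient (isIsomorphicSetoid C) |
    ∃ X : C, Indecomposable X ∧ Quotient.mk (isIsomorphicSetoid C) X = q}.Finite

/-!
A module supported on `[a, b]` is a graded vector space with two operators `S` (for `α₁`) and `T`
(for `α₂`), of degrees `m` and `n`. As `b - a ≤ m`, the operator `S` is at most one map, from weight
`a` to weight `a + m`, and `S T = T S = 0`; moreover `T` is nilpotent. As `n ≠ 1` is coprime
to `m > 0`, no multiple `c * n` with `c ≥ 0` is equal to `m`, so the `T`-chain out of weight `a`
never meets the one into weight `a + m`.

It is enough to find in each nonzero module `V`, of any dimension, a nonzero retract from a finite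
list: the idempotent that projects an indecomposable `V` onto it is then the identity, so `V` is
isomorphic to the retract. Retracts are given by a homogeneous family of vectors and a dual family
of functionals on which `S` and `T` act by the same matrices (`Shape.Realizes`), and two
indecomposables with retracts of the same shape are isomorphic through the maps that match these
families (`ModEnvMod.nonempty_iso_of_hasShape`).

If `S = 0`, a vector on which a maximal power of `T` does not vanish spans such a retract
(`WeightOperators.exists_realizes_chainShape`). If `S ≠ 0`, compare through `S` the kernel
filtration of `T` in weight `a` with its image filtration in weight `a + m`; a common jump gives a
retract made of two `T`-chains joined by `S` (`WeightOperators.exists_hook_vectors`,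
`WeightOperators.exists_realizes_hookShape`). Their lengths are bounded by `b - a + 1`.
-/

/-! ### Graded vector spaces with two commuting shift operators -/

/-- The operators through which `Ũ_{m,n}` acts on a module supported on `[a, b]`: the projections
`P k` onto the weight spaces, and `S`, `T` for the actions of `α₁`, `α₂`. -/
structure WeightOperators {V : Type*} [AddCommGroup V] [Module ℂ V] (m n a b : ℤ)
    (P : ℤ → Module.End ℂ V) (S T : Module.End ℂ V) : Prop where
  P_apply_P : ∀ k l v, P k (P l v) = if k = l then P l v else 0
  P_eq_zero : ∀ k, k < a ∨ b < k → ∀ v, P k v = 0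
  sum_P : ∀ v, ∑ k ∈ Finset.Icc a b, P k v = v
  S_P : ∀ k v, S (P k v) = P (k + m) (S v)
  T_P : ∀ k v, T (P k v) = P (k + n) (T v)
  S_T : ∀ v, S (T v) = T (S v)

namespace WeightOperators

variable {V : Type*} [AddCommGroup V] [Module ℂ V] {m n a b : ℤ}
  {P : ℤ → Module.End ℂ V} {S T : Module.End ℂ V}

theorem T_pow_P (h : WeightOperators m n a b P S T) (i : ℕ) (k : ℤ) (v : V) :
    (T ^ i) (P k v) = P (k + i * n) ((T ^ i) v) := by
  induction i generalizing v k with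
  | zero => simp
  | succ i ih =>
    rw [pow_succ, Module.End.mul_apply, Module.End.mul_apply, h.T_P, ih]
    congr 2
    push_cast
    ring

theorem ext_P (h : WeightOperators m n a b P S T) {W : Type*} [AddCommGroup W] [Module ℂ W]
    {f g : V →ₗ[ℂ] W} (hfg : ∀ k, a ≤ k → k ≤ b → ∀ v, f (P k v) = g (P k v)) (v : V) :
    f v = g v := by
  rw [← h.sum_P v, map_sum, map_sum]
  refine Finset.sum_congr rfl fun k hk => ?_
  rw [Finset.mem_Icc] at hk
  exact hfg k hk.1 hk.2 v

theorem T_pow_eq_zero (h : WeightOperators m n a b P S T) (hn : n ≠ 0) {N : ℕ}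
    (hN : b - a < N) : T ^ N = 0 := by
  ext v
  refine h.ext_P (g := 0) (fun k hk hk' v => ?_) v
  rw [h.T_pow_P, LinearMap.zero_apply, h.P_eq_zero]
  rcases lt_or_gt_of_ne hn with hn | hn
  · left; nlinarith
  · right; nlinarith

/-- Weights differ by `m` along `S`, so on an interval of length at most `m` only the arrow from
the lower to the upper end is left. -/
theorem S_P_eq_zero (h : WeightOperators m n a b P S T) (habm : b - a ≤ m) {k : ℤ} (hk : k ≠ a)
    (v : V) : S (P k v) = 0 := by
  by_cases hka : k < a
  · rw [h.P_eq_zero k (Or.inl hka), map_zero]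
  · rw [h.S_P, h.P_eq_zero]
    right; lia

theorem S_P_left (h : WeightOperators m n a b P S T) (habm : b - a ≤ m) (v : V) :
    S (P a v) = S v := by
  refine h.ext_P (f := S ∘ₗ P a) (fun k _ _ v => ?_) v
  rw [LinearMap.comp_apply, h.P_apply_P]
  split_ifs with hk
  · rfl
  · rw [map_zero, h.S_P_eq_zero habm (Ne.symm hk)]

theorem P_S (h : WeightOperators m n a b P S T) (habm : b - a ≤ m) (v : V) :
    P (a + m) (S v) = S v := by
  rw [← h.S_P, h.S_P_left habm]

theorem S_T_eq_zero (h : WeightOperators m n a b P S T) (habm : b - a ≤ m) (hn : n ≠ 0) (v : V) :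
    S (T v) = 0 := by
  refine h.ext_P (f := S ∘ₗ T) (g := 0) (fun k hk _ v => ?_) v
  rw [LinearMap.comp_apply, LinearMap.zero_apply]
  by_cases hka : k = a
  · rw [h.T_P, h.S_P_eq_zero habm (by lia)]
  · rw [h.S_T, h.S_P_eq_zero habm hka, map_zero]

end WeightOperators

/-! ### Modules with a given matrix form -/

/-- The matrix form of a finite-dimensional module with a homogeneous basis `ι`: the weights of
the basis vectors, and the matrices of `α₁` and `α₂`. -/
structure Shape where
  /-- the index set of the basis -/
  ι : Type
  [fintype : Fintype ι]
  [decidableEq : DecidableEq ι]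
  /-- the weights of the basis vectors -/
  deg : ι → ℤ
  /-- the matrix of `α₁` -/
  matS : Matrix ι ι ℂ
  /-- the matrix of `α₂` -/
  matT : Matrix ι ι ℂ

attribute [instance] Shape.fintype Shape.decidableEq

/-- A module of shape `sh` as a retract of `V`: the `x t` give a homomorphism from it into `V`,
the `ξ t` are the coordinates of a homomorphism from `V` onto it, and the two compose to the
identity. -/
structure Shape.Realizes {V : Type*} [AddCommGroup V] [Module ℂ V] (sh : Shape)
    (P : ℤ → Module.End ℂ V) (S T : Module.End ℂ V) (x : sh.ι → V) (ξ : sh.ι → Module.Dual ℂ V) :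
    Prop where
  P_vec : ∀ t, P (sh.deg t) (x t) = x t
  P_cov : ∀ t v, ξ t (P (sh.deg t) v) = ξ t v
  S_vec : ∀ t, S (x t) = ∑ s, sh.matS s t • x s
  S_cov : ∀ s v, ξ s (S v) = ∑ t, sh.matS s t * ξ t v
  T_vec : ∀ t, T (x t) = ∑ s, sh.matT s t • x s
  T_cov : ∀ s v, ξ s (T v) = ∑ t, sh.matT s t * ξ t v
  pairing : ∀ s t, ξ s (x t) = if s = t then 1 else 0

namespace Shape

variable {V W U : Type*} [AddCommGroup V] [Module ℂ V] [AddCommGroup W] [Module ℂ W]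
  [AddCommGroup U] [Module ℂ U] (sh : Shape)

/-- The map from `V` to `W` that factors through the module of shape `sh`. -/
noncomputable def transfer (ξ : sh.ι → Module.Dual ℂ V) (y : sh.ι → W) : V →ₗ[ℂ] W :=
  ∑ t, (ξ t).smulRight (y t)

theorem transfer_apply (ξ : sh.ι → Module.Dual ℂ V) (y : sh.ι → W) (v : V) :
    sh.transfer ξ y v = ∑ t, ξ t v • y t := by
  simp [transfer]

variable {sh}

theorem transfer_comm {A : Module.End ℂ V} {B : Module.End ℂ W} {M : Matrix sh.ι sh.ι ℂ}
    {ξ : sh.ι → Module.Dual ℂ V} {y : sh.ι → W} (hξ : ∀ s v, ξ s (A v) = ∑ t, M s t * ξ t v)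
    (hy : ∀ t, B (y t) = ∑ s, M s t • y s) (v : V) :
    sh.transfer ξ y (A v) = B (sh.transfer ξ y v) := by
  simp only [transfer_apply, map_sum, map_smul, hξ, hy, Finset.sum_smul, Finset.smul_sum,
    smul_smul]
  rw [Finset.sum_comm]
  simp only [mul_comm]

theorem transfer_transfer {P : ℤ → Module.End ℂ W} {S T : Module.End ℂ W}
    {ξ : sh.ι → Module.Dual ℂ V} {y : sh.ι → W} {η : sh.ι → Module.Dual ℂ W} {z : sh.ι → U}
    (hW : sh.Realizes P S T y η) (v : V) :
    sh.transfer η z (sh.transfer ξ y v) = sh.transfer ξ z v := by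
  rw [sh.transfer_apply ξ y, map_sum]
  simp only [transfer_apply, map_smul, hW.pairing, ite_smul, one_smul, zero_smul,
    Finset.sum_ite_eq', Finset.mem_univ, if_true]

theorem transfer_P {m n a b : ℤ} {P : ℤ → Module.End ℂ V} {S T : Module.End ℂ V}
    {P' : ℤ → Module.End ℂ W} {S' T' : Module.End ℂ W}
    {x : sh.ι → V} {ξ : sh.ι → Module.Dual ℂ V} {y : sh.ι → W} {η : sh.ι → Module.Dual ℂ W}
    (hP : WeightOperators m n a b P S T) (hP' : WeightOperators m n a b P' S' T')
    (hV : sh.Realizes P S T x ξ) (hW : sh.Realizes P' S' T' y η) (k : ℤ) (v : V) :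
    sh.transfer ξ y (P k v) = P' k (sh.transfer ξ y v) := by
  refine transfer_comm (M := Matrix.diagonal fun t => if sh.deg t = k then 1 else 0)
    (fun s v => ?_) (fun t => ?_) v
  · rw [← hV.P_cov, hP.P_apply_P]
    simp only [Matrix.diagonal_apply, ite_mul, zero_mul, Finset.sum_ite_eq, Finset.mem_univ,
      if_true, one_mul]
    split_ifs with hk
    · rw [← hk, hV.P_cov]
    · simp
  · rw [← hW.P_vec, hP'.P_apply_P]
    simp only [Matrix.diagonal_apply, ite_smul, zero_smul, Finset.sum_ite_eq', Finset.mem_univ,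
      if_true, one_smul]
    simp only [hW.P_vec, eq_comm]

end Shape

/-- The matrix of a Jordan block: basis vector `t` goes to basis vector `t + 1`. -/
def jordanBlock (d : ℕ) : Matrix (Fin (d + 1)) (Fin (d + 1)) ℂ :=
  fun s t => if s.val = t.val + 1 then 1 else 0

section JordanBlock

variable {V : Type*} [AddCommGroup V] [Module ℂ V] {T : Module.End ℂ V}

theorem apply_pow_eq_sum_jordanBlock {d : ℕ} {v : V} (hv : (T ^ (d + 1)) v = 0)
    (t : Fin (d + 1)) :
    T ((T ^ t.val) v) = ∑ s : Fin (d + 1), jordanBlock d s t • (T ^ s.val) v := by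
  rw [← Module.End.mul_apply, ← pow_succ']
  simp only [jordanBlock, ite_smul, one_smul, zero_smul]
  by_cases ht : t.val + 1 < d + 1
  · rw [Finset.sum_eq_single ⟨t.val + 1, ht⟩]
    · simp
    · intro s _ hs
      rw [if_neg fun h => hs (Fin.ext h)]
    · simp
  · rw [Finset.sum_eq_zero fun s _ => if_neg (by lia), show t.val + 1 = d + 1 by lia, hv]

theorem dual_pow_apply_eq_sum_jordanBlock {d : ℕ} {φ : Module.Dual ℂ V}
    (hφ : ∀ v, φ ((T ^ (d + 1)) v) = 0) (s : Fin (d + 1)) (v : V) :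
    φ ((T ^ (d - s.val)) (T v)) =
      ∑ t : Fin (d + 1), jordanBlock d s t * φ ((T ^ (d - t.val)) v) := by
  rw [← Module.End.mul_apply, ← pow_succ]
  simp only [jordanBlock, ite_mul, one_mul, zero_mul]
  obtain ⟨s, hs⟩ := s
  cases s with
  | zero => rw [Finset.sum_eq_zero fun t _ => if_neg (by simp)]; exact hφ v
  | succ s =>
    rw [Finset.sum_eq_single ⟨s, by lia⟩]
    · simp only [if_true]
      rw [show d - (s + 1) + 1 = d - s by lia]
    · intro t _ ht
      rw [if_neg fun h => ht (Fin.ext (by simp at h; lia))]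
    · simp

end JordanBlock

/-! ### Retracts on which `α₁` vanishes -/

theorem exists_dual_eq_one_of_notMem {V : Type*} [AddCommGroup V] [Module ℂ V]
    {p : Submodule ℂ V} {v : V} (hv : v ∉ p) :
    ∃ f : Module.Dual ℂ V, f v = 1 ∧ ∀ w ∈ p, f w = 0 := by
  obtain ⟨f, hf, hfv⟩ := LinearMap.exists_extend_of_notMem (0 : p →ₗ[ℂ] ℂ) hv 1
  exact ⟨f, hfv, fun w hw => by simpa using congr($hf ⟨w, hw⟩)⟩

/-- The shape of a single `α₂`-chain of length `d + 1` starting in weight `k`. -/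
def chainShape (n k : ℤ) (d : ℕ) : Shape where
  ι := Fin (d + 1)
  deg t := k + t.val * n
  matS := 0
  matT := jordanBlock d

namespace WeightOperators

variable {V : Type*} [AddCommGroup V] [Module ℂ V] {m n a b : ℤ}
  {P : ℤ → Module.End ℂ V} {S T : Module.End ℂ V}

/-- A functional supported in weight `l` kills the other weight spaces. -/
theorem dual_eq_zero (h : WeightOperators m n a b P S T) {φ : Module.Dual ℂ V} {l k : ℤ}
    (hφ : ∀ v, φ (P l v) = φ v) {v : V} (hv : P k v = v) (hkl : k ≠ l) : φ v = 0 := by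
  rw [← hφ, ← hv, h.P_apply_P, if_neg hkl.symm, map_zero]

theorem P_T_pow (h : WeightOperators m n a b P S T) {k : ℤ} {v : V} (hv : P k v = v) (i : ℕ) :
    P (k + i * n) ((T ^ i) v) = (T ^ i) v := by
  rw [← h.T_pow_P, hv]

theorem dual_T_pow_P (h : WeightOperators m n a b P S T) {φ : Module.Dual ℂ V} {l : ℤ}
    (hφ : ∀ v, φ (P l v) = φ v) {i : ℕ} {k : ℤ} (hk : k + i * n = l) (v : V) :
    φ ((T ^ i) (P k v)) = φ ((T ^ i) v) := by
  rw [h.T_pow_P, hk, hφ]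

/-- A vector `v` with `T ^ d v ≠ 0` and `d` maximal spans a chain, which is a direct summand if
`S = 0`. -/
theorem exists_realizes_chainShape (h : WeightOperators m n a b P S T) (hn : n ≠ 0)
    (hS : ∀ v, S v = 0) [Nontrivial V] :
    ∃ k ∈ Set.Icc a b, ∃ d ∈ Set.Iic (b - a).toNat, ∃ x ξ,
      (chainShape n k d).Realizes P S T x ξ := by
  classical
  have hT : ∃ N, T ^ N = 0 := ⟨(b - a).toNat + 1, h.T_pow_eq_zero hn (by lia)⟩
  obtain ⟨d, hd⟩ : ∃ d, Nat.find hT = d + 1 := by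
    refine Nat.exists_eq_succ_of_ne_zero fun h0 => ?_
    have := Nat.find_spec hT
    rw [h0, pow_zero] at this
    exact one_ne_zero this
  have hd0 : T ^ (d + 1) = 0 := hd ▸ Nat.find_spec hT
  have hd1 : T ^ d ≠ 0 := Nat.find_min hT (by lia)
  obtain ⟨k, hka, hkb, w, hw⟩ : ∃ k, a ≤ k ∧ k ≤ b ∧ ∃ w, (T ^ d) (P k w) ≠ 0 := by
    by_contra! hcon
    exact hd1 (LinearMap.ext fun v => h.ext_P (g := 0) (fun k hk hk' v => hcon k hk hk' v) v)
  obtain ⟨v, hv, hvd⟩ : ∃ v, P k v = v ∧ (T ^ d) v ≠ 0 :=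
    ⟨P k w, by rw [h.P_apply_P, if_pos rfl], hw⟩
  obtain ⟨φ₀, hφ₀⟩ : ∃ φ₀ : Module.Dual ℂ V, φ₀ ((T ^ d) v) = 1 :=
    (exists_dual_eq_one_of_notMem (p := ⊥) (by simpa using hvd)).imp fun _ hf => hf.1
  obtain ⟨φ, hφ, hφv⟩ : ∃ φ : Module.Dual ℂ V, (∀ w, φ (P (k + d * n) w) = φ w) ∧
      φ ((T ^ d) v) = 1 :=
    ⟨φ₀ ∘ₗ P (k + d * n), fun w => by simp [h.P_apply_P], by simp [h.P_T_pow hv, hφ₀]⟩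
  refine ⟨k, ⟨hka, hkb⟩, d, ?_, fun t => (T ^ t.val) v, fun t => φ ∘ₗ (T ^ (d - t.val)), ?_⟩
  · by_contra hcon
    rw [Set.mem_Iic] at hcon
    exact hd1 (h.T_pow_eq_zero hn (by lia))
  · refine ⟨fun t => h.P_T_pow hv t.val, fun t w => ?_, fun t => ?_, fun s w => ?_, fun t => ?_,
      fun s w => ?_, fun s t => ?_⟩
    · refine h.dual_T_pow_P hφ ?_ w
      have ht : t.val ≤ d := Nat.lt_succ_iff.mp t.isLt
      simp only [chainShape]
      push_cast [ht]
      ring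
    · rw [hS]
      exact (Finset.sum_eq_zero fun s _ => zero_smul ℂ _).symm
    · rw [hS, map_zero]
      exact (Finset.sum_eq_zero fun t _ => zero_mul _).symm
    · exact apply_pow_eq_sum_jordanBlock (by simp [hd0]) t
    · exact dual_pow_apply_eq_sum_jordanBlock (by simp [hd0]) s w
    · have hs : s.val ≤ d := Nat.lt_succ_iff.mp s.isLt
      change φ ((T ^ (d - s.val)) ((T ^ t.val) v)) = _
      rw [← Module.End.mul_apply, ← pow_add]
      split_ifs with hst
      · rw [← hst, Nat.sub_add_cancel hs, hφv]
      · refine h.dual_eq_zero hφ (h.P_T_pow hv _) fun hk => hst (Fin.ext ?_)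
        have := mul_right_cancel₀ hn (add_left_cancel hk)
        have : d - s.val + t.val = d := by exact_mod_cast this
        lia

end WeightOperators

/-! ### Retracts on which `α₁` does not vanish -/

/-- The shape of two `α₂`-chains, one of length `i + 1` starting in weight `a`, the other of length
`j + 1` ending in weight `a + m`, with `α₁` taking the start of the first to the end of the
second. -/
def hookShape (m n a : ℤ) (i j : ℕ) : Shape where
  ι := Fin (i + 1) ⊕ Fin (j + 1)
  deg := Sum.elim (fun t => a + t.val * n) (fun t => a + m - j * n + t.val * n)
  matS := Matrix.fromBlocks 0 0 (Matrix.single (Fin.last j) 0 1) 0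
  matT := Matrix.fromBlocks (jordanBlock i) 0 0 (jordanBlock j)

namespace WeightOperators

variable {V : Type*} [AddCommGroup V] [Module ℂ V] {m n a b : ℤ}
  {P : ℤ → Module.End ℂ V} {S T : Module.End ℂ V}

/-- Let `K i` be the kernel of `T ^ i` in weight `a` and `I j` the image of `T ^ j` in weight
`a + m`. The vectors and functionals exist as soon as `S (K (i + 1)) ∩ I j` is not contained in
`I (j + 1) + S (K i)`; here `i` is chosen minimal with `S (K (i + 1)) ≠ 0`, so that `S (K i) = 0`,
and then `j` maximal with `S (K (i + 1)) ∩ I j ≠ 0`. -/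
theorem exists_hook_vectors (h : WeightOperators m n a b P S T) (hn : n ≠ 0) (habm : b - a ≤ m)
    (hS : S ≠ 0) :
    ∃ i ∈ Set.Iic (b - a).toNat, ∃ j ∈ Set.Iic (b - a).toNat,
    ∃ (v u : V) (φ ψ : Module.Dual ℂ V),
      P a v = v ∧ P (a + m - j * n) u = u ∧
      (∀ w, φ (P (a + i * n) w) = φ w) ∧ (∀ w, ψ (P (a + m) w) = ψ w) ∧
      (T ^ (i + 1)) v = 0 ∧ S v = (T ^ j) u ∧ ψ (S v) = 1 ∧
      (∀ w, ψ ((T ^ (j + 1)) w) = 0) ∧ (∀ w, φ ((T ^ i) w) = ψ (S w)) := by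
  classical
  set N := (b - a).toNat with hN
  have hTN : T ^ (N + 1) = 0 := h.T_pow_eq_zero hn (by lia)
  -- A nonzero power of `T` moves weights of `[a, b]` by at most `b - a`, which bounds `i` and `j`.
  have hTd : ∀ d, T ^ d ≠ 0 → d ∈ Set.Iic N := fun d hd => by
    by_contra hcon
    rw [Set.mem_Iic] at hcon
    exact hd (h.T_pow_eq_zero hn (by lia))
  obtain ⟨w₀, hw₀⟩ : ∃ w, S w ≠ 0 := by
    by_contra! hcon
    exact hS (LinearMap.ext hcon)
  have hi : ∃ i, ∃ v, P a v = v ∧ (T ^ (i + 1)) v = 0 ∧ S v ≠ 0 :=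
    ⟨N, P a w₀, by rw [h.P_apply_P, if_pos rfl], by simp [hTN], by rwa [h.S_P_left habm]⟩
  obtain ⟨i, ⟨v₁, hv₁, hTv₁, hSv₁⟩, hmin⟩ : ∃ i, (∃ v, P a v = v ∧ (T ^ (i + 1)) v = 0 ∧ S v ≠ 0) ∧
      ∀ v, P a v = v → (T ^ i) v = 0 → S v = 0 := by
    refine ⟨Nat.find hi, Nat.find_spec hi, fun v hv hTv => ?_⟩
    by_contra hSv
    rcases Nat.eq_zero_or_pos (Nat.find hi) with h0 | h0
    · rw [h0] at hTv
      exact hSv (by rw [show v = 0 from hTv, map_zero])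
    · refine Nat.find_min hi (Nat.sub_one_lt_of_lt h0) ⟨v, hv, ?_, hSv⟩
      rwa [Nat.sub_add_cancel h0]
  have hj : ∃ j, ∀ v, P a v = v → (T ^ (i + 1)) v = 0 → S v ∈ LinearMap.range (T ^ (j + 1)) →
      S v = 0 := ⟨N, fun v _ _ hv => by simpa [hTN] using hv⟩
  obtain ⟨j, hmax, v, hv, hTv, hSv, hvj⟩ : ∃ j, (∀ v, P a v = v → (T ^ (i + 1)) v = 0 →
      S v ∈ LinearMap.range (T ^ (j + 1)) → S v = 0) ∧
      ∃ v, P a v = v ∧ (T ^ (i + 1)) v = 0 ∧ S v ≠ 0 ∧ S v ∈ LinearMap.range (T ^ j) := by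
    refine ⟨Nat.find hj, Nat.find_spec hj, ?_⟩
    rcases Nat.eq_zero_or_pos (Nat.find hj) with h0 | h0
    · exact ⟨v₁, hv₁, hTv₁, hSv₁, by rw [h0]; exact ⟨_, rfl⟩⟩
    · have := Nat.find_min hj (Nat.sub_one_lt_of_lt h0)
      push Not at this
      rw [Nat.sub_add_cancel h0] at this
      obtain ⟨v, h1, h2, h3, h4⟩ := this
      exact ⟨v, h1, h2, h4, h3⟩
  obtain ⟨u₀, hu₀⟩ := hvj
  obtain ⟨u, hu, hSu⟩ : ∃ u, P (a + m - j * n) u = u ∧ S v = (T ^ j) u :=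
    ⟨P (a + m - j * n) u₀, by rw [h.P_apply_P, if_pos rfl], by
      rw [h.T_pow_P, sub_add_cancel, hu₀, h.P_S habm]⟩
  obtain ⟨ψ₀, hψ₀, hψ₀T⟩ := exists_dual_eq_one_of_notMem (p := LinearMap.range (T ^ (j + 1)))
    (v := S v) fun hmem => hSv (hmax v hv hTv hmem)
  obtain ⟨ψ, hψ, hψS, hψT⟩ : ∃ ψ : Module.Dual ℂ V, (∀ w, ψ (P (a + m) w) = ψ w) ∧
      ψ (S v) = 1 ∧ ∀ w, ψ ((T ^ (j + 1)) w) = 0 := by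
    refine ⟨ψ₀ ∘ₗ P (a + m), fun w => by simp [h.P_apply_P], by simp [h.P_S habm, hψ₀],
      fun w => hψ₀T _ ⟨P (a + m - (j + 1 : ℕ) * n) w, ?_⟩⟩
    rw [h.T_pow_P, sub_add_cancel]
  obtain ⟨φ₀, hφ₀⟩ : ∃ φ₀ : Module.Dual ℂ V, ∀ w, φ₀ ((T ^ i) (P a w)) = ψ (S w) := by
    -- By the choice of `i`, `S` factors through `T ^ i` in weight `a`, so `ψ ∘ S` extends along it.
    have hmem : ψ ∘ₗ S ∈ LinearMap.range ((T ^ i) ∘ₗ P a).dualMap := by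
      rw [LinearMap.range_dualMap_eq_dualAnnihilator_ker, Submodule.mem_dualAnnihilator]
      intro w hw
      have := hmin (P a w) (by rw [h.P_apply_P, if_pos rfl]) hw
      rw [h.S_P_left habm] at this
      rw [LinearMap.comp_apply, this, map_zero]
    obtain ⟨φ₀, hφ₀⟩ := hmem
    exact ⟨φ₀, fun w => congr($hφ₀ w)⟩
  refine ⟨i, hTd i fun h0 => hSv (hmin v hv (by simp [h0])), j, hTd j fun h0 => hSv ?_, v, u,
    φ₀ ∘ₗ P (a + i * n), ψ, hv, hu, fun w => by simp [h.P_apply_P], hψ, hTv, hSu, hψS, hψT,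
    fun w => ?_⟩
  · rw [hSu, h0, LinearMap.zero_apply]
  · rw [LinearMap.comp_apply, ← h.T_pow_P, hφ₀]

/-- If `S ≠ 0`, the chains through `v` and `u` of `exists_hook_vectors` span a retract. Since `m` is
no multiple `c * n`, their weights are disjoint, which makes the two families of functionals
dual to them. -/
theorem exists_realizes_hookShape (h : WeightOperators m n a b P S T) (hn : n ≠ 0)
    (habm : b - a ≤ m) (hmn : ∀ c : ℕ, m ≠ c * n) (hS : S ≠ 0) :
    ∃ i ∈ Set.Iic (b - a).toNat, ∃ j ∈ Set.Iic (b - a).toNat, ∃ x ξ,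
      (hookShape m n a i j).Realizes P S T x ξ := by
  obtain ⟨i, hi, j, hj, v, u, φ, ψ, hv, hu, hφ, hψ, hTv, hSv, hψS, hψT, hφψ⟩ :=
    h.exists_hook_vectors hn habm hS
  have hST : ∀ w, S (T w) = 0 := h.S_T_eq_zero habm hn
  have hTS : ∀ w, T (S w) = 0 := fun w => by rw [← h.S_T, hST]
  have hS_pow : ∀ (l : ℕ) w, S ((T ^ (l + 1)) w) = 0 := fun l w => by
    rw [pow_succ', Module.End.mul_apply, hST]
  have hpow_S : ∀ (l : ℕ) w, (T ^ (l + 1)) (S w) = 0 := fun l w => by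
    rw [pow_succ, Module.End.mul_apply, hTS, map_zero]
  have hTu : (T ^ (j + 1)) u = 0 := by
    rw [pow_succ', Module.End.mul_apply, ← hSv, hTS]
  -- `φ ∘ T ^ i = ψ ∘ S` holds in all weights, and `S T = 0`.
  have hφT : ∀ w, φ ((T ^ (i + 1)) w) = 0 := fun w => by
    rw [pow_succ, Module.End.mul_apply, hφψ, hST, map_zero]
  have hSu : S u = 0 := by
    rw [← hu, h.S_P_eq_zero habm]
    exact fun hk => hmn j (by linarith)
  have hφS : ∀ w, φ (S w) = 0 := fun w =>
    h.dual_eq_zero hφ (h.P_S habm w) fun hk => hmn i (by linarith)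
  have hle : ∀ {d : ℕ} (t : Fin (d + 1)), t.val ≤ d := fun t => Nat.lt_succ_iff.mp t.isLt
  refine ⟨i, hi, j, hj, Sum.elim (fun t => (T ^ t.val) v) (fun t => (T ^ t.val) u),
    Sum.elim (fun t => φ ∘ₗ (T ^ (i - t.val))) (fun t => ψ ∘ₗ (T ^ (j - t.val))), ?_⟩
  refine ⟨?_, ?_, ?_, ?_, ?_, ?_, ?_⟩
  · rintro (t | t)
    · exact h.P_T_pow hv t.val
    · exact h.P_T_pow hu t.val
  · rintro (t | t) w
    · refine h.dual_T_pow_P hφ ?_ w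
      simp only [hookShape, Sum.elim_inl]
      push_cast [hle t]
      ring
    · refine h.dual_T_pow_P hψ ?_ w
      simp only [hookShape, Sum.elim_inr]
      push_cast [hle t]
      ring
  · rintro (t | t)
    · refine Eq.trans ?_ (Fintype.sum_sum_type _).symm
      simp only [hookShape, Matrix.fromBlocks_apply₁₁, Matrix.fromBlocks_apply₂₁, Sum.elim_inl,
        Sum.elim_inr, Matrix.zero_apply, zero_smul, Finset.sum_const_zero, zero_add,
        Matrix.single_apply, ite_smul, one_smul, ite_and, Finset.sum_ite_eq, Finset.mem_univ,
        if_true]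
      induction t using Fin.cases with
      | zero => simpa using hSv
      | succ t => simpa [(Fin.succ_ne_zero t).symm] using hS_pow t.val v
    · refine Eq.trans ?_ (Fintype.sum_sum_type _).symm
      simp only [hookShape, Matrix.fromBlocks_apply₁₂, Matrix.fromBlocks_apply₂₂, Sum.elim_inr,
        Matrix.zero_apply, zero_smul, Finset.sum_const_zero, zero_add]
      induction t using Fin.cases with
      | zero => simpa using hSu
      | succ t => exact hS_pow t.val u
  · rintro (s | s) w
    · refine Eq.trans ?_ (Fintype.sum_sum_type _).symm
      simp only [hookShape, Matrix.fromBlocks_apply₁₁, Matrix.fromBlocks_apply₁₂, Sum.elim_inl,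
        Matrix.zero_apply, zero_mul, Finset.sum_const_zero, zero_add, LinearMap.comp_apply]
      rcases Nat.eq_zero_or_pos (i - s.val) with h0 | h0
      · rw [h0]
        exact hφS w
      · rw [← Nat.sub_add_cancel h0, hpow_S, map_zero]
    · refine Eq.trans ?_ (Fintype.sum_sum_type _).symm
      simp only [hookShape, Matrix.fromBlocks_apply₂₁, Matrix.fromBlocks_apply₂₂, Sum.elim_inl,
        Sum.elim_inr, Matrix.zero_apply, zero_mul, Finset.sum_const_zero, add_zero,
        Matrix.single_apply, ite_mul, one_mul, ite_and, LinearMap.comp_apply]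
      by_cases hs : Fin.last j = s
      · subst hs
        simp [hφψ]
      · have hs' : s.val ≠ j := fun h' => hs (Fin.ext h'.symm)
        rw [← Nat.sub_add_cancel (show 0 < j - s.val by have := hle s; lia), hpow_S, map_zero]
        simp [hs]
  · rintro (t | t)
    · refine Eq.trans ?_ (Fintype.sum_sum_type _).symm
      simp only [hookShape, Matrix.fromBlocks_apply₁₁, Matrix.fromBlocks_apply₂₁, Sum.elim_inl,
        Sum.elim_inr, Matrix.zero_apply, zero_smul, Finset.sum_const_zero, add_zero]
      exact apply_pow_eq_sum_jordanBlock hTv t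
    · refine Eq.trans ?_ (Fintype.sum_sum_type _).symm
      simp only [hookShape, Matrix.fromBlocks_apply₁₂, Matrix.fromBlocks_apply₂₂, Sum.elim_inl,
        Sum.elim_inr, Matrix.zero_apply, zero_smul, Finset.sum_const_zero, zero_add]
      exact apply_pow_eq_sum_jordanBlock hTu t
  · rintro (s | s) w
    · refine Eq.trans ?_ (Fintype.sum_sum_type _).symm
      simp only [hookShape, Matrix.fromBlocks_apply₁₁, Matrix.fromBlocks_apply₁₂, Sum.elim_inl,
        Sum.elim_inr, Matrix.zero_apply, zero_mul, Finset.sum_const_zero, add_zero]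
      exact dual_pow_apply_eq_sum_jordanBlock hφT s w
    · refine Eq.trans ?_ (Fintype.sum_sum_type _).symm
      simp only [hookShape, Matrix.fromBlocks_apply₂₁, Matrix.fromBlocks_apply₂₂, Sum.elim_inl,
        Sum.elim_inr, Matrix.zero_apply, zero_mul, Finset.sum_const_zero, zero_add]
      exact dual_pow_apply_eq_sum_jordanBlock hψT s w
  · have hcast : ∀ {p q : ℕ}, (p : ℤ) * n = q * n → p = q := fun hpq => by
      exact_mod_cast mul_right_cancel₀ hn hpq
    rintro (s | s) (t | t)
    · change φ ((T ^ (i - s.val)) ((T ^ t.val) v)) = _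
      rw [← Module.End.mul_apply, ← pow_add]
      split_ifs with hst
      · rw [← Sum.inl.inj hst, Nat.sub_add_cancel (hle s), hφψ, hψS]
      · refine h.dual_eq_zero hφ (h.P_T_pow hv _) fun hk => hst (congrArg Sum.inl (Fin.ext ?_))
        have := hcast (add_left_cancel hk)
        have := hle s
        omega
    · change φ ((T ^ (i - s.val)) ((T ^ t.val) u)) = _
      rw [← Module.End.mul_apply, ← pow_add, if_neg (by simp)]
      refine h.dual_eq_zero hφ (h.P_T_pow hu _) fun hk => hmn (j - t.val + s.val) ?_
      push_cast [hle s, hle t] at hk ⊢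
      linarith
    · change ψ ((T ^ (j - s.val)) ((T ^ t.val) v)) = _
      rw [← Module.End.mul_apply, ← pow_add, if_neg (by simp)]
      refine h.dual_eq_zero hψ (h.P_T_pow hv _) fun hk => hmn (j - s.val + t.val) ?_
      linarith
    · change ψ ((T ^ (j - s.val)) ((T ^ t.val) u)) = _
      rw [← Module.End.mul_apply, ← pow_add]
      split_ifs with hst
      · rw [← Sum.inr.inj hst, Nat.sub_add_cancel (hle s), ← hSv, hψS]
      · refine h.dual_eq_zero hψ (h.P_T_pow hu _) fun hk => hst (congrArg Sum.inr (Fin.ext ?_))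
        have := hcast (p := j - s.val + t.val) (q := j) (by linarith)
        have := hle s
        omega

end WeightOperators

/-! ### The operators on a module with bounded support -/

namespace ModEnvMod

variable {m n a b : ℤ}

/-- The action of `α₁` on a module supported on `[a, b]`, as the sum of the `α₁ aₖ`. -/
noncomputable def opS (a b : ℤ) (V : ModEnvMod.{u} m n) : Module.End ℂ V.carrier :=
  ∑ k ∈ Finset.Icc a b, V.act (ModEnv.mono m n (1, k, 0))

/-- The action of `α₂` on a module supported on `[a, b]`, as the sum of the `aₖ α₂`. -/
noncomputable def opT (a b : ℤ) (V : ModEnvMod.{u} m n) : Module.End ℂ V.carrier :=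
  ∑ k ∈ Finset.Icc a b, V.act (ModEnv.mono m n (0, k, 1))

/-- The projection onto the `k`-th weight space. -/
noncomputable def opP (V : ModEnvMod.{u} m n) (k : ℤ) : Module.End ℂ V.carrier :=
  V.act (ModEnv.idem m n k)

theorem act_mono_mono (V : ModEnvMod.{u} m n) (p q : ℕ × ℤ × ℕ) (v : V.carrier) :
    V.act (ModEnv.mono m n p) (V.act (ModEnv.mono m n q) v) =
      if p.2.1 - q.1 * m = q.2.1 + p.2.2 * n then
        V.act (ModEnv.mono m n (p.1 + q.1, q.2.1 + p.2.2 * n, p.2.2 + q.2.2)) v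
      else 0 := by
  rw [← Module.End.mul_apply, ← map_mul, ModEnv.mono_mul_mono, ModEnv.monoMul]
  split_ifs
  · rfl
  · rw [map_zero, LinearMap.zero_apply]

theorem opP_opP (V : ModEnvMod.{u} m n) (k l : ℤ) (v : V.carrier) :
    V.opP k (V.opP l v) = if k = l then V.opP l v else 0 := by
  simp [opP, ModEnv.idem, act_mono_mono]

section Supported

variable {V : ModEnvMod.{u} m n}

theorem opP_eq_zero (hV : supportedOn m n a b V) {k : ℤ} (hk : k < a ∨ b < k) (v : V.carrier) :
    V.opP k v = 0 := by
  have := hV k hk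
  rw [weightSpace, LinearMap.range_eq_bot] at this
  rw [opP, this, LinearMap.zero_apply]

theorem sum_opP (hV : supportedOn m n a b V) (v : V.carrier) :
    ∑ k ∈ Finset.Icc a b, V.opP k v = v := by
  have hv : v ∈ ⨆ k : ℤ, LinearMap.range (V.act (ModEnv.idem m n k)) := by
    rw [V.iSup_weight]; trivial
  induction hv using Submodule.iSup_induction' with
  | mem l v hv =>
    obtain ⟨w, rfl⟩ := hv
    change ∑ k ∈ Finset.Icc a b, V.opP k (V.opP l w) = V.opP l w
    simp only [opP_opP, Finset.sum_ite_eq']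
    split_ifs with hl
    · rfl
    · rw [opP_eq_zero hV (by rw [Finset.mem_Icc] at hl; lia)]
  | zero => simp
  | add v w _ _ hv hw => simp only [map_add, Finset.sum_add_distrib, hv, hw]

theorem opS_opP (hV : supportedOn m n a b V) (k : ℤ) (v : V.carrier) :
    V.opS a b (V.opP k v) = V.act (ModEnv.mono m n (1, k, 0)) v := by
  have h : V.act (ModEnv.mono m n (1, k, 0)) v =
      V.act (ModEnv.mono m n (1, k, 0)) (V.opP k v) := by
    simp [opP, ModEnv.idem, act_mono_mono]
  by_cases hk : k ∈ Finset.Icc a b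
  · rw [opS, LinearMap.sum_apply, Finset.sum_eq_single k, h]
    · intro l _ hl
      simp [opP, ModEnv.idem, act_mono_mono, hl]
    · exact fun hk' => absurd hk hk'
  · rw [h, opP_eq_zero hV (by rw [Finset.mem_Icc] at hk; lia), map_zero, map_zero]

theorem opP_opS (hV : supportedOn m n a b V) (k : ℤ) (v : V.carrier) :
    V.opP (k + m) (V.opS a b v) = V.act (ModEnv.mono m n (1, k, 0)) v := by
  have h : V.act (ModEnv.mono m n (1, k, 0)) v =
      V.act (ModEnv.mono m n (1, k, 0)) (V.opP k v) := by
    simp [opP, ModEnv.idem, act_mono_mono]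
  rw [opS, LinearMap.sum_apply, map_sum]
  by_cases hk : k ∈ Finset.Icc a b
  · rw [Finset.sum_eq_single k]
    · simp [opP, ModEnv.idem, act_mono_mono]
    · intro l _ hl
      simp [opP, ModEnv.idem, act_mono_mono, hl.symm]
    · exact fun hk' => absurd hk hk'
  · rw [h, opP_eq_zero hV (by rw [Finset.mem_Icc] at hk; lia), map_zero]
    refine Finset.sum_eq_zero fun l hl => ?_
    have : k ≠ l := fun h => hk (h ▸ hl)
    simp [opP, ModEnv.idem, act_mono_mono, this]

theorem opP_opT (hV : supportedOn m n a b V) (k : ℤ) (v : V.carrier) :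
    V.opP k (V.opT a b v) = V.act (ModEnv.mono m n (0, k, 1)) v := by
  have h : V.act (ModEnv.mono m n (0, k, 1)) v =
      V.opP k (V.act (ModEnv.mono m n (0, k, 1)) v) := by
    simp [opP, ModEnv.idem, act_mono_mono]
  by_cases hk : k ∈ Finset.Icc a b
  · rw [opT, LinearMap.sum_apply, map_sum, Finset.sum_eq_single k, ← h]
    · intro l _ hl
      simp [opP, ModEnv.idem, act_mono_mono, hl.symm]
    · exact fun hk' => absurd hk hk'
  · rw [h, opP_eq_zero hV, opP_eq_zero hV] <;> rw [Finset.mem_Icc] at hk <;> lia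

theorem opT_opP (hV : supportedOn m n a b V) (k : ℤ) (v : V.carrier) :
    V.opT a b (V.opP k v) = V.act (ModEnv.mono m n (0, k + n, 1)) v := by
  have h : V.act (ModEnv.mono m n (0, k + n, 1)) v =
      V.opP (k + n) (V.act (ModEnv.mono m n (0, k + n, 1)) v) := by
    simp [opP, ModEnv.idem, act_mono_mono]
  rw [opT, LinearMap.sum_apply]
  by_cases hk : k + n ∈ Finset.Icc a b
  · rw [Finset.sum_eq_single (k + n)]
    · simp [opP, ModEnv.idem, act_mono_mono]
    · intro l _ hl
      simp [opP, ModEnv.idem, act_mono_mono, hl]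
    · exact fun hk' => absurd hk hk'
  · rw [h, opP_eq_zero hV (k := k + n) (by rw [Finset.mem_Icc] at hk; lia)]
    refine Finset.sum_eq_zero fun l hl => ?_
    have : l ≠ k + n := fun h => hk (h ▸ hl)
    simp [opP, ModEnv.idem, act_mono_mono, this]

theorem opS_opT (hV : supportedOn m n a b V) (v : V.carrier) :
    V.opS a b (V.opT a b v) = V.opT a b (V.opS a b v) := by
  rw [← sum_opP hV v]
  simp only [map_sum]
  refine Finset.sum_congr rfl fun k _ => ?_
  have h1 : V.opS a b (V.opT a b (V.opP k v)) = V.act (ModEnv.mono m n (1, k + n, 1)) v := by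
    have h : V.act (ModEnv.mono m n (0, k + n, 1)) v =
        V.opP (k + n) (V.act (ModEnv.mono m n (0, k + n, 1)) v) := by
      simp [opP, ModEnv.idem, act_mono_mono]
    rw [opT_opP hV, h, opS_opP hV, act_mono_mono]
    simp
  have h2 : V.opT a b (V.opS a b (V.opP k v)) = V.act (ModEnv.mono m n (1, k + n, 1)) v := by
    have h : V.act (ModEnv.mono m n (1, k, 0)) v =
        V.opP (k + m) (V.act (ModEnv.mono m n (1, k, 0)) v) := by
      simp [opP, ModEnv.idem, act_mono_mono]
    rw [opS_opP hV, h, opT_opP hV, act_mono_mono, if_pos (by push_cast; ring)]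
    simp
  rw [h1, h2]

theorem weightOperators (hV : supportedOn m n a b V) :
    WeightOperators m n a b V.opP (V.opS a b) (V.opT a b) where
  P_apply_P := V.opP_opP
  P_eq_zero _ hk := opP_eq_zero hV hk
  sum_P := sum_opP hV
  S_P k v := by rw [opS_opP hV, opP_opS hV]
  T_P k v := by rw [opT_opP hV, opP_opT hV]
  S_T := opS_opT hV

/-- The algebra is generated by the `aₖ`, the `α₁ aₖ` and the `aₖ α₂`. -/
theorem map_act_of_comm {W : ModEnvMod.{u} m n} (hV : supportedOn m n a b V)
    (hW : supportedOn m n a b W) {f : V.carrier →ₗ[ℂ] W.carrier}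
    (hP : ∀ k v, f (V.opP k v) = W.opP k (f v)) (hS : ∀ v, f (V.opS a b v) = W.opS a b (f v))
    (hT : ∀ v, f (V.opT a b v) = W.opT a b (f v)) (x : ModEnv m n) (v : V.carrier) :
    f (V.act x v) = W.act x (f v) := by
  have hmono₀ : ∀ (s : ℕ) (k : ℤ) (v : V.carrier), f (V.act (ModEnv.mono m n (0, k, s)) v) =
      W.act (ModEnv.mono m n (0, k, s)) (f v) := by
    intro s
    induction s with
    | zero => exact hP
    | succ s ih =>
      intro k v
      have h : ∀ (U : ModEnvMod.{u} m n) (v : U.carrier),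
          U.act (ModEnv.mono m n (0, k, s + 1)) v = U.act (ModEnv.mono m n (0, k, s))
            (U.act (ModEnv.mono m n (0, k - s * n, 1)) v) := fun U v => by
        simp [act_mono_mono]
      rw [h, ih, ← opP_opT hV, hP, hT, opP_opT hW, ← h]
  have hmono : ∀ (r : ℕ) (k : ℤ) (s : ℕ) (v : V.carrier),
      f (V.act (ModEnv.mono m n (r, k, s)) v) = W.act (ModEnv.mono m n (r, k, s)) (f v) := by
    intro r k s v
    induction r with
    | zero => exact hmono₀ s k v
    | succ r ih =>
      have h : ∀ (U : ModEnvMod.{u} m n) (v : U.carrier),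
          U.act (ModEnv.mono m n (r + 1, k, s)) v = U.act (ModEnv.mono m n (1, k + r * m, 0))
            (U.act (ModEnv.mono m n (r, k, s)) v) := fun U v => by
        simp [act_mono_mono, add_comm]
      rw [h, ← opS_opP hV, hS, hP, opS_opP hW, ih, ← h]
  induction x using ModEnv.induction_mono with
  | h0 => simp
  | hadd x y hx hy => simp only [map_add, LinearMap.add_apply, hx, hy]
  | hsm c p => simp only [map_smul, LinearMap.smul_apply, hmono]

end Supported

/-! ### Idempotents and indecomposability -/

/-- The action on an invariant subspace. -/
noncomputable def actOn (V : ModEnvMod.{u} m n) (N : Submodule ℂ V.carrier)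
    (hN : ∀ x, ∀ v ∈ N, V.act x v ∈ N) : ModEnv m n →ₙₐ[ℂ] Module.End ℂ N where
  toFun x := (V.act x).restrict (hN x)
  map_smul' c x := LinearMap.ext fun v => Subtype.ext (by
    change V.act (c • x) v.1 = c • V.act x v.1
    rw [map_smul, LinearMap.smul_apply])
  map_zero' := LinearMap.ext fun v => Subtype.ext (by
    change V.act 0 v.1 = 0
    rw [map_zero, LinearMap.zero_apply])
  map_add' x y := LinearMap.ext fun v => Subtype.ext (by
    change V.act (x + y) v.1 = V.act x v.1 + V.act y v.1
    rw [map_add, LinearMap.add_apply])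
  map_mul' x y := LinearMap.ext fun v => Subtype.ext (by
    change V.act (x * y) v.1 = V.act x (V.act y v.1)
    rw [map_mul, Module.End.mul_apply])

/-- An invariant subspace of a module with bounded support, as a module. -/
noncomputable def submoduleMod {V : ModEnvMod.{u} m n} (hV : supportedOn m n a b V)
    (N : Submodule ℂ V.carrier) (hN : ∀ x, ∀ v ∈ N, V.act x v ∈ N) : ModEnvMod.{u} m n where
  carrier := N
  act := V.actOn N hN
  iSup_weight := by
    refine eq_top_iff.mpr fun v _ => ?_
    have hv : v = ∑ k ∈ Finset.Icc a b, V.actOn N hN (ModEnv.idem m n k) v := by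
      refine Subtype.ext ?_
      rw [AddSubmonoidClass.coe_finsetSum]
      exact (sum_opP hV v.1).symm
    rw [hv]
    exact Submodule.sum_mem _ fun k _ => Submodule.mem_iSup_of_mem k ⟨v, rfl⟩

theorem submoduleMod_supportedOn {V : ModEnvMod.{u} m n} (hV : supportedOn m n a b V)
    (N : Submodule ℂ V.carrier) (hN : ∀ x, ∀ v ∈ N, V.act x v ∈ N) :
    supportedOn m n a b (submoduleMod hV N hN) := fun k hk => by
  rw [weightSpace, LinearMap.range_eq_bot]
  exact LinearMap.ext fun v => Subtype.ext (opP_eq_zero hV hk v.1)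

/-- An invariant subspace of an object of `SupportCat`, as an object. -/
noncomputable def ofInvariant (V : SupportCat.{u} m n a b) (N : Submodule ℂ V.obj.carrier)
    (hN : ∀ x, ∀ v ∈ N, V.obj.act x v ∈ N) : SupportCat.{u} m n a b :=
  ⟨submoduleMod V.property N hN, submoduleMod_supportedOn V.property N hN⟩

/-- A linear map that commutes with the action, as a morphism. -/
noncomputable def homOfComm {V W : SupportCat.{u} m n a b} (f : V.obj.carrier →ₗ[ℂ] W.obj.carrier)
    (hf : ∀ x v, f (V.obj.act x v) = W.obj.act x (f v)) : V ⟶ W :=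
  ObjectProperty.homMk ⟨f, hf⟩

theorem isZero_iff_subsingleton (V : SupportCat.{u} m n a b) :
    IsZero V ↔ Subsingleton V.obj.carrier := by
  rw [IsZero.iff_id_eq_zero]
  constructor
  · intro h
    have h' : (LinearMap.id : V.obj.carrier →ₗ[ℂ] V.obj.carrier) = 0 :=
      congrArg (fun f : V ⟶ V => f.hom.1) h
    exact ⟨fun x y => sub_eq_zero.mp congr($h' (x - y))⟩
  · intro h
    exact ObjectProperty.hom_ext _ (Subtype.ext (LinearMap.ext fun v => Subsingleton.elim _ _))

/-- An idempotent endomorphism `e` splits `V` as the sum of its range and its kernel. -/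
theorem eq_zero_or_eq_one_of_indecomposable {V : SupportCat.{u} m n a b} (hV : Indecomposable V)
    {e : Module.End ℂ V.obj.carrier} (he : ∀ x v, e (V.obj.act x v) = V.obj.act x (e v))
    (hee : ∀ v, e (e v) = e v) : e = 0 ∨ e = 1 := by
  let Y := ofInvariant V (LinearMap.range e) fun x v hv => by
    obtain ⟨w, rfl⟩ := hv
    exact ⟨_, he x w⟩
  let Z := ofInvariant V (LinearMap.ker e) fun x v hv => by
    rw [LinearMap.mem_ker] at hv ⊢
    rw [he, hv, map_zero]
  let B : BinaryBicone Y Z :=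
    { pt := V
      fst := homOfComm e.rangeRestrict fun x v => Subtype.ext (he x v)
      snd := homOfComm ((1 - e).codRestrict (LinearMap.ker e) fun v => by simp [hee])
        fun x v => Subtype.ext (by
          change V.obj.act x v - e (V.obj.act x v) = V.obj.act x (v - e v)
          rw [he, map_sub])
      inl := homOfComm (LinearMap.range e).subtype fun _ _ => rfl
      inr := homOfComm (LinearMap.ker e).subtype fun _ _ => rfl
      inl_fst := ObjectProperty.hom_ext _ (Subtype.ext (LinearMap.ext fun v => Subtype.ext (by
        obtain ⟨_, w, rfl⟩ := v
        exact hee w)))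
      inl_snd := ObjectProperty.hom_ext _ (Subtype.ext (LinearMap.ext fun v => Subtype.ext (by
        obtain ⟨_, w, rfl⟩ := v
        exact sub_eq_zero.mpr (hee w).symm)))
      inr_fst := ObjectProperty.hom_ext _ (Subtype.ext (LinearMap.ext fun v => Subtype.ext v.2))
      inr_snd := ObjectProperty.hom_ext _ (Subtype.ext (LinearMap.ext fun v => Subtype.ext (by
        change v.1 - e v.1 = v.1
        rw [LinearMap.mem_ker.mp v.2, sub_zero]))) }
  have hB : B.IsBilimit := isBinaryBilimitOfTotal B
    (ObjectProperty.hom_ext _ (Subtype.ext (LinearMap.ext fun v => add_sub_cancel (e v) v)))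
  rcases hV.2 Y Z (biprod.uniqueUpToIso Y Z hB) with h | h
  · left
    have : Subsingleton (LinearMap.range e) := (isZero_iff_subsingleton Y).mp h
    exact LinearMap.range_eq_bot.mp (Submodule.eq_bot_of_subsingleton)
  · right
    have : Subsingleton (LinearMap.ker e) := (isZero_iff_subsingleton Z).mp h
    have hker : LinearMap.ker e = ⊥ := Submodule.eq_bot_of_subsingleton
    exact LinearMap.ext fun v => LinearMap.ker_eq_bot.mp hker (hee v)

/-- `V` has the module of shape `sh` as a retract. -/
def HasShape (V : SupportCat.{u} m n a b) (sh : Shape) : Prop :=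
  ∃ x ξ, sh.Realizes V.obj.opP (V.obj.opS a b) (V.obj.opT a b) x ξ

/-- An indecomposable module is isomorphic to each of its nonzero retracts, so that it is
determined by the shape of one of them. -/
theorem nonempty_iso_of_hasShape {sh : Shape} [Nonempty sh.ι] {V W : SupportCat.{u} m n a b}
    (hV : Indecomposable V) (hW : Indecomposable W) (hVsh : HasShape V sh)
    (hWsh : HasShape W sh) : Nonempty (V ≅ W) := by
  obtain ⟨x, ξ, hx⟩ := hVsh
  obtain ⟨y, η, hy⟩ := hWsh
  have comm : ∀ {V W : SupportCat.{u} m n a b} {x : sh.ι → V.obj.carrier}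
      {ξ : sh.ι → Module.Dual ℂ V.obj.carrier} {y : sh.ι → W.obj.carrier}
      {η : sh.ι → Module.Dual ℂ W.obj.carrier},
      sh.Realizes V.obj.opP (V.obj.opS a b) (V.obj.opT a b) x ξ →
      sh.Realizes W.obj.opP (W.obj.opS a b) (W.obj.opT a b) y η →
      ∀ z v, sh.transfer ξ y (V.obj.act z v) = W.obj.act z (sh.transfer ξ y v) :=
    fun {V W} _ _ _ _ hx hy => map_act_of_comm V.property W.property
      (Shape.transfer_P (weightOperators V.property) (weightOperators W.property) hx hy)
      (Shape.transfer_comm hx.S_cov hy.S_vec) (Shape.transfer_comm hx.T_cov hy.T_vec)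
  have one : ∀ {V : SupportCat.{u} m n a b} {x : sh.ι → V.obj.carrier}
      {ξ : sh.ι → Module.Dual ℂ V.obj.carrier}, Indecomposable V →
      sh.Realizes V.obj.opP (V.obj.opS a b) (V.obj.opT a b) x ξ → sh.transfer ξ x = 1 := by
    intro V x ξ hV hx
    refine (eq_zero_or_eq_one_of_indecomposable hV (comm hx hx)
      fun v => Shape.transfer_transfer hx v).resolve_left fun h0 => ?_
    obtain ⟨t⟩ := ‹Nonempty sh.ι›
    have h1 : sh.transfer ξ x (x t) = x t := by
      simp only [Shape.transfer_apply, hx.pairing, ite_smul, one_smul, zero_smul,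
        Finset.sum_ite_eq', Finset.mem_univ, if_true]
    rw [h0, LinearMap.zero_apply] at h1
    have h2 := hx.pairing t t
    rw [← h1, map_zero, if_pos rfl] at h2
    exact zero_ne_one h2
  refine ⟨⟨homOfComm (sh.transfer ξ y) (comm hx hy), homOfComm (sh.transfer η x) (comm hy hx),
    ObjectProperty.hom_ext _ (Subtype.ext (LinearMap.ext fun v => ?_)),
    ObjectProperty.hom_ext _ (Subtype.ext (LinearMap.ext fun v => ?_))⟩⟩
  · exact (Shape.transfer_transfer hy v).trans congr($(one hV hx) v)
  · exact (Shape.transfer_transfer hx v).trans congr($(one hW hy) v)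

/-- Finitely many shapes among which every nonzero module supported on `[a, b]` has a retract. -/
def shapes (m n a b : ℤ) : Set Shape :=
  (fun p : ℤ × ℕ => chainShape n p.1 p.2) '' (Set.Icc a b ×ˢ Set.Iic (b - a).toNat) ∪
    (fun p : ℕ × ℕ => hookShape m n a p.1 p.2) ''
      (Set.Iic (b - a).toNat ×ˢ Set.Iic (b - a).toNat)

theorem finite_shapes (m n a b : ℤ) : (shapes m n a b).Finite :=
  (((Set.finite_Icc a b).prod (Set.finite_Iic _)).image _).union
    (((Set.finite_Iic _).prod (Set.finite_Iic _)).image _)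

theorem nonempty_of_mem_shapes {sh : Shape} (hsh : sh ∈ shapes m n a b) : Nonempty sh.ι := by
  rcases hsh with ⟨p, -, rfl⟩ | ⟨p, -, rfl⟩
  · exact ⟨(0 : Fin _)⟩
  · exact ⟨Sum.inl (0 : Fin _)⟩

theorem exists_hasShape (hn : n ≠ 0) (habm : b - a ≤ m) (hmn : ∀ c : ℕ, m ≠ c * n)
    (V : SupportCat.{u} m n a b) (hV : ¬ IsZero V) : ∃ sh ∈ shapes m n a b, HasShape V sh := by
  have : Nontrivial V.obj.carrier := by
    rwa [isZero_iff_subsingleton, not_subsingleton_iff_nontrivial] at hV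
  have hw := weightOperators V.property
  by_cases hS : V.obj.opS a b = 0
  · obtain ⟨k, hk, d, hd, h⟩ := hw.exists_realizes_chainShape hn fun v => by
      rw [hS, LinearMap.zero_apply]
    exact ⟨_, Or.inl ⟨(k, d), ⟨hk, hd⟩, rfl⟩, h⟩
  · obtain ⟨i, hi, j, hj, h⟩ := hw.exists_realizes_hookShape hn habm hmn hS
    exact ⟨_, Or.inr ⟨(i, j), ⟨hi, hj⟩, rfl⟩, h⟩

end ModEnvMod

theorem mainTheorem1 (m n : ℤ) (hm : m ≠ 0) (hn : n ≠ 0) (hmn : IsCoprime m n) (hn1 : n ≠ 1)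
    (a b : ℤ) (hab : 0 ≤ b - a) (habm : b - a ≤ m) :
    IsFiniteRepType (ModEnvMod.SupportCat.{u} m n a b) := by
  have hmul : ∀ c : ℕ, m ≠ c * n := by
    intro c hc
    have hunit : IsUnit n := hmn.isUnit_of_dvd' ⟨c, by rw [hc, mul_comm]⟩ dvd_rfl
    rcases Int.isUnit_iff.mp hunit with h | h
    · exact hn1 h
    -- For `n = -1`, the multiples `c * n` are not positive, while `m > 0`.
    · rw [h] at hc
      lia
  refine ((ModEnvMod.finite_shapes m n a b).biUnion (t := fun sh =>
    {q | ∃ X : ModEnvMod.SupportCat.{u} m n a b, Indecomposable X ∧ ModEnvMod.HasShape X sh ∧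
      Quotient.mk (isIsomorphicSetoid _) X = q}) fun sh hsh => ?_).subset ?_
  · have := ModEnvMod.nonempty_of_mem_shapes hsh
    refine Set.Subsingleton.finite ?_
    rintro _ ⟨X, hX, hXsh, rfl⟩ _ ⟨Y, hY, hYsh, rfl⟩
    exact Quotient.sound (ModEnvMod.nonempty_iso_of_hasShape hX hY hXsh hYsh)
  · rintro _ ⟨X, hX, rfl⟩
    obtain ⟨sh, hsh, hXsh⟩ := ModEnvMod.exists_hasShape hn habm hmul X hX.1
    exact Set.mem_biUnion hsh ⟨X, hX, hXsh, rfl⟩
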